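/- Let $(X,\mathcal A,\mu)$ be an arbitrary measure space (no finiteness or $\sigma$-finiteness is assumed), and let $\phi : X \to X$ be a measure-preserving transformation, i.e. $\phi$ is measurable and $\mu(\phi^{-1}(E)) = \mu(E)$ for every measurable $E \subseteq X$. (This includes the case where $\phi$ is a bijection of $X$ onto itself such that $E$ is measurable if and only if $\phi(E)$ is measurable, and $\mu(\phi(E)) = \mu(E)$ for every measurable $E$.) Let $1 \le p < \infty$ and let $f \in L^p(X,\mu)$ be real- or complex-valued. Then for $\mu$-almost every $x \in X$ the averages $$\frac{1}{n+1} \sum_{j=0}^{n} f(\phi^j(x))$$ converge to a finite limit (a real or complex number, respectively) as $n \to \infty$. -/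

import Mathlib

/-! # Birkhoff's pointwise ergodic theorem on an arbitrary measure space -/

open MeasureTheory Filter Topology

/-! ### Maximal ergodic inequality -/

section Maximal

variable {X : Type*}

/-! Let `E` be the invariant set where the averages have upper limit above `b` and lower limit below
`a < b`. The maximal ergodic theorem on `E`, for `f - b` and `a - f`, gives `b μ(E) ≤ ∫_E f ≤ a
μ(E)`, hence `μ(E) = 0`, provided `μ(E) < ∞`. Finiteness comes from
`integrable_and_integral_nonneg_of_birkhoffSum_pos`: for `c > 0` the positive part of `f - c` is
integrable, and the theorem turns this into integrability of `f - c` on `E`. -/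

/-- The maximum of `0` and the first `n` Birkhoff sums of `g`, defined recursively. -/
noncomputable def birkhoffMax (φ : X → X) (g : X → ℝ) : ℕ → X → ℝ
  | 0, _ => 0
  | n + 1, x => max 0 (g x + birkhoffMax φ g n (φ x))

lemma birkhoffMax_nonneg (φ : X → X) (g : X → ℝ) (n : ℕ) (x : X) :
    0 ≤ birkhoffMax φ g n x := by
  cases n with
  | zero => exact le_rfl
  | succ n => exact le_max_left _ _

lemma birkhoffMax_le_succ (φ : X → X) (g : X → ℝ) (n : ℕ) (x : X) :
    birkhoffMax φ g n x ≤ birkhoffMax φ g (n + 1) x := by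
  induction n generalizing x with
  | zero => exact birkhoffMax_nonneg φ g 1 x
  | succ n ih => exact max_le_max le_rfl (add_le_add le_rfl (ih (φ x)))

lemma monotone_birkhoffMax (φ : X → X) (g : X → ℝ) : Monotone (birkhoffMax φ g) :=
  monotone_nat_of_le_succ fun n x => birkhoffMax_le_succ φ g n x

lemma birkhoffSum_le_birkhoffMax (φ : X → X) (g : X → ℝ) (n : ℕ) (x : X) :
    birkhoffSum φ g n x ≤ birkhoffMax φ g n x := by
  induction n generalizing x with
  | zero => simp [birkhoffMax]
  | succ n ih =>
    rw [birkhoffSum_succ']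
    exact (add_le_add le_rfl (ih (φ x))).trans (le_max_right _ _)

lemma birkhoffSum_sub_const (φ : X → X) (f : X → ℝ) (c : ℝ) (n : ℕ) (x : X) :
    birkhoffSum φ (fun y => f y - c) n x = birkhoffSum φ f n x - n * c := by
  simp [birkhoffSum, Finset.sum_sub_distrib]

variable [MeasurableSpace X] {μ : Measure X} {φ : X → X} {f g : X → ℝ}

lemma measurable_birkhoffMax (hφ : Measurable φ) (hg : Measurable g) (n : ℕ) :
    Measurable (birkhoffMax φ g n) := by
  induction n with
  | zero => exact measurable_const
  | succ n ih => exact measurable_const.max (hg.add (ih.comp hφ))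

lemma lintegral_birkhoffMax_lt_top (hφ : MeasurePreserving φ μ μ) (hg : Measurable g)
    (hint : ∫⁻ x, ENNReal.ofReal (g x) ∂μ < ⊤) (n : ℕ) :
    ∫⁻ x, ENNReal.ofReal (birkhoffMax φ g n x) ∂μ < ⊤ := by
  induction n with
  | zero => simp [birkhoffMax]
  | succ n ih =>
    have hm := (measurable_birkhoffMax hφ.measurable hg n).ennreal_ofReal
    calc ∫⁻ x, ENNReal.ofReal (birkhoffMax φ g (n + 1) x) ∂μ
        ≤ ∫⁻ x, ENNReal.ofReal (g x) + ENNReal.ofReal (birkhoffMax φ g n (φ x)) ∂μ := by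
          refine lintegral_mono fun x => ?_
          simp only [birkhoffMax, ENNReal.ofReal_max, ENNReal.ofReal_zero, zero_le, sup_of_le_right]
          exact ENNReal.ofReal_add_le
      _ < ⊤ := by
          rw [lintegral_add_left hg.ennreal_ofReal, hφ.lintegral_comp hm]
          exact ENNReal.add_lt_top.2 ⟨hint, ih⟩

/-- Write `M n` for `birkhoffMax φ g n`. Where `M (n+1) > 0` it equals `g + M n ∘ φ`, so `M (n+1) +
g⁻ = M n ∘ φ + g⁺` there. Integrate, use invariance of `μ` and `M n ≤ M (n+1)`, and cancel the
finite integral of `M (n+1)`. -/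
lemma lintegral_neg_part_indicator_le (hφ : MeasurePreserving φ μ μ) (hg : Measurable g)
    (hint : ∫⁻ x, ENNReal.ofReal (g x) ∂μ < ⊤) (n : ℕ) :
    ∫⁻ x, {x | 0 < birkhoffMax φ g n x}.indicator (fun x => ENNReal.ofReal (-g x)) x ∂μ
      ≤ ∫⁻ x, ENNReal.ofReal (g x) ∂μ := by
  cases n with
  | zero => simp [birkhoffMax]
  | succ n =>
    have hm := (measurable_birkhoffMax hφ.measurable hg n).ennreal_ofReal
    have hm' := (measurable_birkhoffMax hφ.measurable hg (n + 1)).ennreal_ofReal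
    refine (ENNReal.add_le_add_iff_left
      (lintegral_birkhoffMax_lt_top hφ hg hint (n + 1)).ne).1 ?_
    rw [← lintegral_add_left hm']
    calc _ ≤ ∫⁻ x, ENNReal.ofReal (birkhoffMax φ g n (φ x)) + ENNReal.ofReal (g x) ∂μ := by
          refine lintegral_mono fun x => ?_
          by_cases hx : 0 < birkhoffMax φ g (n + 1) x
          · have hx' : 0 < g x + birkhoffMax φ g n (φ x) := by simpa [birkhoffMax] using hx
            have hn := birkhoffMax_nonneg φ g n (φ x)
            have he : birkhoffMax φ g (n + 1) x = g x + birkhoffMax φ g n (φ x) :=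
              max_eq_right hx'.le
            simp only [Set.indicator, Set.mem_ofPred_eq, hx, if_true]
            rcases le_total 0 (g x) with h | h
            · rw [ENNReal.ofReal_of_nonpos (p := -g x) (by linarith), add_zero,
                ← ENNReal.ofReal_add hn h, he, add_comm]
            · rw [ENNReal.ofReal_of_nonpos h, add_zero, he,
                ← ENNReal.ofReal_add hx'.le (by linarith)]
              exact ENNReal.ofReal_le_ofReal (by linarith)
          · simp [Set.indicator, hx, ENNReal.ofReal_of_nonpos (not_lt.1 hx)]
      _ = ∫⁻ x, ENNReal.ofReal (birkhoffMax φ g n x) ∂μ + ∫⁻ x, ENNReal.ofReal (g x) ∂μ := by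
          rw [lintegral_add_right _ hg.ennreal_ofReal, hφ.lintegral_comp hm]
      _ ≤ _ := by
          gcongr
          exact birkhoffMax_le_succ φ g n _

/-- A form of the maximal ergodic theorem: only the positive part of `g` is assumed integrable. -/
theorem integrable_and_integral_nonneg_of_birkhoffSum_pos (hφ : MeasurePreserving φ μ μ)
    (hg : Measurable g) (hint : ∫⁻ x, ENNReal.ofReal (g x) ∂μ < ⊤)
    (hpos : ∀ᵐ x ∂μ, ∃ n, 0 < birkhoffSum φ g n x) :
    Integrable g μ ∧ 0 ≤ ∫ x, g x ∂μ := by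
  have hle : ∫⁻ x, ENNReal.ofReal (-g x) ∂μ ≤ ∫⁻ x, ENNReal.ofReal (g x) ∂μ := by
    calc ∫⁻ x, ENNReal.ofReal (-g x) ∂μ
        ≤ ∫⁻ x, ⨆ n, {x | 0 < birkhoffMax φ g n x}.indicator
            (fun x => ENNReal.ofReal (-g x)) x ∂μ := by
          refine lintegral_mono_ae (hpos.mono fun x ⟨n, hn⟩ => ?_)
          refine le_iSup_of_le n ?_
          have : 0 < birkhoffMax φ g n x := hn.trans_le (birkhoffSum_le_birkhoffMax φ g n x)
          simp [Set.indicator, this]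
      _ = ⨆ n, ∫⁻ x, {x | 0 < birkhoffMax φ g n x}.indicator
            (fun x => ENNReal.ofReal (-g x)) x ∂μ := by
          refine lintegral_iSup (fun n => ?_) fun m n hmn x => ?_
          · exact hg.neg.ennreal_ofReal.indicator
              (measurableSet_lt measurable_const (measurable_birkhoffMax hφ.measurable hg n))
          · exact Set.indicator_le_indicator_of_subset
              (fun y (hy : 0 < birkhoffMax φ g m y) =>
                hy.trans_le (monotone_birkhoffMax φ g hmn y)) (fun _ => zero_le) x
      _ ≤ _ := iSup_le (lintegral_neg_part_indicator_le hφ hg hint)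
  have hgi : Integrable g μ := by
    refine ⟨hg.aestronglyMeasurable, ?_⟩
    calc ∫⁻ x, ‖g x‖ₑ ∂μ
        ≤ ∫⁻ x, ENNReal.ofReal (g x) + ENNReal.ofReal (-g x) ∂μ := by
          refine lintegral_mono fun x => ?_
          rw [Real.enorm_eq_ofReal_abs]
          rcases abs_cases (g x) with ⟨h, -⟩ | ⟨h, -⟩ <;> rw [h]
          · exact le_self_add
          · exact le_add_self
      _ < ⊤ := by
          rw [lintegral_add_left hg.ennreal_ofReal]
          exact ENNReal.add_lt_top.2 ⟨hint, hle.trans_lt hint⟩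
  refine ⟨hgi, ?_⟩
  rw [integral_eq_lintegral_pos_part_sub_lintegral_neg_part hgi, sub_nonneg]
  exact ENNReal.toReal_mono hint.ne hle

/-- The positive part lives on `{c ≤ |f|}`, of finite measure by Chebyshev, where `L^p` functions
are integrable. -/
lemma MeasureTheory.MemLp.lintegral_ofReal_sub_lt_top {p : ENNReal} (hp : 1 ≤ p) (hp' : p ≠ ⊤)
    (hf : MemLp f p μ) (hfm : Measurable f) {c : ℝ} (hc : 0 < c) :
    ∫⁻ x, ENNReal.ofReal (f x - c) ∂μ < ⊤ := by
  set s : Set X := {x | ENNReal.ofReal c ≤ ‖f x‖₊}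
  have hs : MeasurableSet s := measurableSet_le measurable_const hfm.nnnorm.coe_nnreal_ennreal
  have hμs : μ s < ⊤ :=
    hf.meas_ge_lt_top' (zero_lt_one.trans_le hp).ne' hp' (by simpa using hc)
  have : IsFiniteMeasure (μ.restrict s) := ⟨by simpa using hμs⟩
  have hi : Integrable f (μ.restrict s) := (hf.restrict s).integrable hp
  calc ∫⁻ x, ENNReal.ofReal (f x - c) ∂μ
      ≤ ∫⁻ x, s.indicator (fun x => ‖f x‖ₑ) x ∂μ := by
        refine lintegral_mono fun x => ?_
        by_cases hx : x ∈ s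
        · rw [Set.indicator_of_mem hx, Real.enorm_eq_ofReal_abs]
          exact ENNReal.ofReal_le_ofReal (by linarith [le_abs_self (f x)])
        · have h1 : ‖f x‖ₑ < ENNReal.ofReal c := not_le.1 hx
          rw [Real.enorm_eq_ofReal_abs, ENNReal.ofReal_lt_ofReal_iff hc] at h1
          rw [ENNReal.ofReal_of_nonpos (by linarith [le_abs_self (f x)])]
          exact zero_le
    _ = ∫⁻ x in s, ‖f x‖ₑ ∂μ := lintegral_indicator hs _
    _ < ⊤ := hi.2

/-- If the Birkhoff averages of `f ∈ L^p` exceed a positive level `b` at some time everywhere on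
an invariant set, then this set has finite measure and `f` has mean at least `b` on it. -/
lemma measure_lt_top_and_mul_le_setIntegral {p : ENNReal} (hφ : MeasurePreserving φ μ μ)
    (hp : 1 ≤ p) (hp' : p ≠ ⊤) (hf : MemLp f p μ) (hfm : Measurable f) {E : Set X}
    (hE : MeasurableSet E) (hinv : φ ⁻¹' E = E) {b : ℝ} (hb : 0 < b)
    (hpos : ∀ x ∈ E, ∃ n : ℕ, n * b < birkhoffSum φ f n x) :
    μ E < ⊤ ∧ IntegrableOn f E μ ∧ μ.real E * b ≤ ∫ x in E, f x ∂μ := by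
  have hφE : MeasurePreserving φ (μ.restrict E) (μ.restrict E) := by
    simpa only [hinv] using hφ.restrict_preimage hE
  have key : ∀ c, 0 < c → c ≤ b → Integrable (fun x => f x - c) (μ.restrict E) ∧
      0 ≤ ∫ x in E, (f x - c) ∂μ := by
    intro c hc hcb
    refine integrable_and_integral_nonneg_of_birkhoffSum_pos hφE (hfm.sub_const c)
      ((hf.restrict E).lintegral_ofReal_sub_lt_top hp hp' hfm hc) ?_
    filter_upwards [ae_restrict_mem hE] with x hx
    obtain ⟨n, hn⟩ := hpos x hx
    refine ⟨n, ?_⟩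
    rw [birkhoffSum_sub_const, sub_pos]
    exact (mul_le_mul_of_nonneg_left hcb n.cast_nonneg).trans_lt hn
  obtain ⟨h1, h2⟩ := key b hb le_rfl
  -- Two levels `b` and `b / 2` make the nonzero constant `b / 2` integrable on `E`, forcing `μ E <
  -- ⊤`.
  have h3 := ((key (b / 2) (by linarith) (by linarith)).1.sub h1)
  have h4 : Integrable (fun _ : X => b / 2) (μ.restrict E) := by
    refine h3.congr (ae_of_all _ fun x => ?_)
    simp only [Pi.sub_apply]
    ring
  rw [integrable_const_iff] at h4
  have h5 : IsFiniteMeasure (μ.restrict E) := h4.resolve_left (by linarith)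
  have hμE : μ E < ⊤ := by simpa using measure_lt_top (μ.restrict E) Set.univ
  have hfi : Integrable f (μ.restrict E) := (hf.restrict E).integrable hp
  refine ⟨hμE, hfi, ?_⟩
  rw [integral_sub hfi (integrable_const b), setIntegral_const, smul_eq_mul] at h2
  linarith

end Maximal

/-! ### Oscillation of the averages -/

section Oscillation

variable {X : Type*}

/-- The set of points at which the upper limit of the Birkhoff averages of `f` exceeds `b`. -/
def birkhoffLimsupGT (φ : X → X) (f : X → ℝ) (b : ℝ) : Set X :=
  {x | ∃ q : ℚ, b < q ∧ ∃ᶠ n : ℕ in atTop, n * (q : ℝ) < birkhoffSum φ f n x}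

/-- Lowering the threshold from `q` to `r` gains `n * (q - r)`, which eventually absorbs the single
term `f x` and the index shift. -/
lemma preimage_birkhoffLimsupGT (φ : X → X) (f : X → ℝ) (b : ℝ) :
    φ ⁻¹' birkhoffLimsupGT φ f b = birkhoffLimsupGT φ f b := by
  have large : ∀ (d C : ℝ), 0 < d → ∀ᶠ n : ℕ in atTop, C < n * d := fun d C hd =>
    (tendsto_natCast_atTop_atTop.atTop_mul_const hd).eventually_gt_atTop C
  ext x
  constructor
  · rintro ⟨q, hbq, hq⟩
    obtain ⟨r, hbr, hrq⟩ := exists_rat_btwn hbq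
    refine ⟨r, hbr, ?_⟩
    have h1 : ∃ᶠ n : ℕ in atTop, ((n + 1 : ℕ) : ℝ) * (r : ℝ) < birkhoffSum φ f (n + 1) x := by
      refine (hq.and_eventually (large (q - r) (r - f x) (by linarith))).mono ?_
      rintro n ⟨h, h'⟩
      rw [birkhoffSum_succ']
      push_cast
      nlinarith
    exact (tendsto_add_atTop_nat 1).frequently h1
  · rintro ⟨q, hbq, hq⟩
    obtain ⟨r, hbr, hrq⟩ := exists_rat_btwn hbq
    refine ⟨r, hbr, ?_⟩
    have h1 : ∃ᶠ n : ℕ in atTop, ((n + 1 : ℕ) : ℝ) * (q : ℝ) < birkhoffSum φ f (n + 1) x := by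
      rw [← map_add_atTop_eq_nat 1, frequently_map] at hq
      exact hq
    refine (h1.and_eventually (large (q - r) (f x - q) (by linarith))).mono ?_
    rintro n ⟨h, h'⟩
    rw [birkhoffSum_succ'] at h
    push_cast at h
    nlinarith

lemma exists_lt_birkhoffSum_of_mem {φ : X → X} {f : X → ℝ} {b : ℝ} {x : X}
    (hx : x ∈ birkhoffLimsupGT φ f b) : ∃ n : ℕ, n * b < birkhoffSum φ f n x := by
  obtain ⟨q, hbq, hq⟩ := hx
  obtain ⟨n, hn⟩ := hq.exists
  exact ⟨n, (mul_le_mul_of_nonneg_left hbq.le n.cast_nonneg).trans_lt hn⟩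

lemma mem_birkhoffLimsupGT_of_frequently {φ : X → X} {f : X → ℝ} {b c : ℝ} {x : X} (hbc : b < c)
    (h : ∃ᶠ n in atTop, c < birkhoffAverage ℝ φ f n x) : x ∈ birkhoffLimsupGT φ f b := by
  obtain ⟨q, hbq, hqc⟩ := exists_rat_btwn hbc
  refine ⟨q, hbq, (h.and_eventually (eventually_gt_atTop 0)).mono ?_⟩
  rintro n ⟨hn, hn0⟩
  have hn0' : (0 : ℝ) < n := by exact_mod_cast hn0
  rw [birkhoffAverage, smul_eq_mul, inv_mul_eq_div, lt_div_iff₀ hn0'] at hn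
  nlinarith

lemma isBoundedUnder_le_birkhoffAverage {φ : X → X} {f : X → ℝ} {x : X}
    (hx : x ∉ ⋂ k : ℕ, birkhoffLimsupGT φ f k) :
    IsBoundedUnder (· ≤ ·) atTop fun n => birkhoffAverage ℝ φ f n x := by
  obtain ⟨k, hk⟩ : ∃ k : ℕ, x ∉ birkhoffLimsupGT φ f k := by simpa using hx
  refine ⟨(k : ℝ) + 1, ?_⟩
  rw [eventually_map]
  by_contra h
  refine hk (mem_birkhoffLimsupGT_of_frequently (lt_add_one (k : ℝ)) ?_)
  simpa only [not_eventually, not_le] using h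

variable [MeasurableSpace X] {μ : Measure X} {φ : X → X} {f : X → ℝ}

lemma measurable_birkhoffSum (hφ : Measurable φ) (hf : Measurable f) (n : ℕ) :
    Measurable (birkhoffSum φ f n) :=
  Finset.measurable_fun_sum _ fun i _ => hf.comp (hφ.iterate i)

lemma measurableSet_birkhoffLimsupGT (hφ : Measurable φ) (hf : Measurable f) (b : ℝ) :
    MeasurableSet (birkhoffLimsupGT φ f b) := by
  simp only [birkhoffLimsupGT, frequently_atTop]
  refine Measurable.setOf (.exists fun q => ?_)
  refine .and measurable_const (.forall fun N => .exists fun n => .and measurable_const ?_)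
  exact measurableSet_setOfPred.1 (measurableSet_lt measurable_const (measurable_birkhoffSum hφ hf n))

lemma measure_oscillation_eq_zero_of_pos {p : ENNReal} (hφ : MeasurePreserving φ μ μ)
    (hp : 1 ≤ p) (hp' : p ≠ ⊤) (hf : MemLp f p μ) (hfm : Measurable f) {a b : ℝ} (hab : a < b)
    (hb : 0 < b) : μ (birkhoffLimsupGT φ f b ∩ birkhoffLimsupGT φ (-f) (-a)) = 0 := by
  set E := birkhoffLimsupGT φ f b ∩ birkhoffLimsupGT φ (-f) (-a)
  have hE : MeasurableSet E := (measurableSet_birkhoffLimsupGT hφ.measurable hfm b).inter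
    (measurableSet_birkhoffLimsupGT hφ.measurable hfm.neg (-a))
  have hinv : φ ⁻¹' E = E := by
    rw [Set.preimage_inter, preimage_birkhoffLimsupGT, preimage_birkhoffLimsupGT]
  obtain ⟨hfin, hfi, hle⟩ := measure_lt_top_and_mul_le_setIntegral hφ hp hp' hf hfm hE hinv hb
    fun x hx => exists_lt_birkhoffSum_of_mem hx.1
  have : IsFiniteMeasure (μ.restrict E) := ⟨by simpa using hfin⟩
  have hφE : MeasurePreserving φ (μ.restrict E) (μ.restrict E) := by
    simpa only [hinv] using hφ.restrict_preimage hE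
  -- Since `μ E` is now finite, the sign of `a` is irrelevant.
  have hgi : Integrable (fun x => (-f) x - -a) (μ.restrict E) := hfi.neg.sub (integrable_const _)
  have hge := (integrable_and_integral_nonneg_of_birkhoffSum_pos hφE (hfm.neg.sub_const (-a))
    hgi.lintegral_lt_top (by
      filter_upwards [ae_restrict_mem hE] with x hx
      obtain ⟨n, hn⟩ := exists_lt_birkhoffSum_of_mem hx.2
      exact ⟨n, by rw [birkhoffSum_sub_const]; linarith⟩)).2
  rw [integral_sub hfi.neg (integrable_const _), setIntegral_const, smul_eq_mul] at hge
  simp only [Pi.neg_apply, integral_neg] at hge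
  have h0 : μ.real E = 0 := by
    have h1 : 0 ≤ μ.real E := measureReal_nonneg
    nlinarith
  exact (measureReal_eq_zero_iff hfin.ne).1 h0

lemma measure_oscillation_eq_zero {p : ENNReal} (hφ : MeasurePreserving φ μ μ)
    (hp : 1 ≤ p) (hp' : p ≠ ⊤) (hf : MemLp f p μ) (hfm : Measurable f) {a b : ℝ} (hab : a < b) :
    μ (birkhoffLimsupGT φ f b ∩ birkhoffLimsupGT φ (-f) (-a)) = 0 := by
  rcases lt_or_ge 0 b with hb | hb
  · exact measure_oscillation_eq_zero_of_pos hφ hp hp' hf hfm hab hb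
  -- Here `-a > 0`, so `-f` with levels `-b < -a` is covered.
  · have := measure_oscillation_eq_zero_of_pos hφ hp hp' hf.neg hfm.neg
      (neg_lt_neg hab) (by linarith)
    rwa [neg_neg, neg_neg, Set.inter_comm] at this

lemma measure_iInter_birkhoffLimsupGT_eq_zero {p : ENNReal} (hφ : MeasurePreserving φ μ μ)
    (hp : 1 ≤ p) (hp' : p ≠ ⊤) (hf : MemLp f p μ) (hfm : Measurable f) :
    μ (⋂ k : ℕ, birkhoffLimsupGT φ f k) = 0 := by
  set E := ⋂ k : ℕ, birkhoffLimsupGT φ f k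
  have hE : MeasurableSet E := .iInter fun k =>
    measurableSet_birkhoffLimsupGT hφ.measurable hfm k
  have hinv : φ ⁻¹' E = E := by
    simp only [E, Set.preimage_iInter, preimage_birkhoffLimsupGT]
  have key := fun k : ℕ => measure_lt_top_and_mul_le_setIntegral hφ hp hp' hf hfm hE hinv
    -- The shift to `k + 1` keeps the level positive.
    (b := ((k + 1 : ℕ) : ℝ)) (by positivity)
    fun x hx => exists_lt_birkhoffSum_of_mem (Set.mem_iInter.1 hx (k + 1))
  have h0 : μ.real E = 0 := by
    by_contra hne
    have hpos : 0 < μ.real E := lt_of_le_of_ne measureReal_nonneg (Ne.symm hne)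
    obtain ⟨k, hk⟩ := exists_nat_gt ((∫ x in E, f x ∂μ) / μ.real E)
    rw [div_lt_iff₀ hpos] at hk
    have := (key k).2.2
    push_cast at this
    nlinarith
  exact (measureReal_eq_zero_iff (key 0).1.ne).1 h0

lemma ae_exists_tendsto_birkhoffAverage_of_measurable {p : ENNReal}
    (hφ : MeasurePreserving φ μ μ) (hp : 1 ≤ p) (hp' : p ≠ ⊤) (hf : MemLp f p μ)
    (hfm : Measurable f) :
    ∀ᵐ x ∂μ, ∃ l : ℝ, Tendsto (fun n => birkhoffAverage ℝ φ f n x) atTop (𝓝 l) := by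
  have hosc : ∀ᵐ x ∂μ, ∀ a b : ℚ, a < b →
      x ∉ birkhoffLimsupGT φ f b ∩ birkhoffLimsupGT φ (-f) (-a) := by
    simp only [ae_all_iff]
    intro a b hab
    exact measure_eq_zero_iff_ae_notMem.1
      (measure_oscillation_eq_zero hφ hp hp' hf hfm (by exact_mod_cast hab))
  filter_upwards [hosc,
    measure_eq_zero_iff_ae_notMem.1 (measure_iInter_birkhoffLimsupGT_eq_zero hφ hp hp' hf hfm),
    measure_eq_zero_iff_ae_notMem.1
      (measure_iInter_birkhoffLimsupGT_eq_zero hφ hp hp' hf.neg hfm.neg)] with x hx hxu hxl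
  have hneg : ∀ n, birkhoffAverage ℝ φ (-f) n x = -birkhoffAverage ℝ φ f n x := fun n => by
    rw [birkhoffAverage_neg, Pi.neg_apply, Pi.neg_apply]
  refine tendsto_of_no_upcrossings dense_univ ?_ (isBoundedUnder_le_birkhoffAverage hxu) ?_
  · rintro a - b - hab ⟨ha, hb⟩
    -- Two rationals `a < r < s < b` leave the strict gaps needed on both sides.
    obtain ⟨r, har, hrb⟩ := exists_rat_btwn hab
    obtain ⟨s, hrs, hsb⟩ := exists_rat_btwn hrb
    refine hx r s (by exact_mod_cast hrs) ⟨mem_birkhoffLimsupGT_of_frequently hsb hb,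
      mem_birkhoffLimsupGT_of_frequently (neg_lt_neg har) (ha.mono fun n hn => ?_)⟩
    rw [hneg]
    exact neg_lt_neg hn
  · have := isBoundedUnder_le_birkhoffAverage hxl
    simp only [hneg] at this
    exact isBoundedUnder_le_neg.1 this

/-- **Birkhoff's pointwise ergodic theorem** for real `L^p` functions, `1 ≤ p < ∞`, on an
arbitrary measure space. -/
theorem ae_exists_tendsto_birkhoffAverage {p : ENNReal} (hφ : MeasurePreserving φ μ μ)
    (hp : 1 ≤ p) (hp' : p ≠ ⊤) (hf : MemLp f p μ) :
    ∀ᵐ x ∂μ, ∃ l : ℝ, Tendsto (fun n => birkhoffAverage ℝ φ f n x) atTop (𝓝 l) := by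
  have hfm := hf.aestronglyMeasurable.stronglyMeasurable_mk.measurable
  have hae := hf.aestronglyMeasurable.ae_eq_mk
  have hsum : ∀ᵐ x ∂μ, ∀ n, birkhoffAverage ℝ φ f n x =
      birkhoffAverage ℝ φ (hf.aestronglyMeasurable.mk f) n x :=
    ae_all_iff.2 fun n =>
      hφ.quasiMeasurePreserving.birkhoffAverage_ae_eq_of_ae_eq ℝ hae n
  filter_upwards [hsum, ae_exists_tendsto_birkhoffAverage_of_measurable hφ hp hp'
    ((memLp_congr_ae hae).1 hf) hfm] with x hx h
  simpa only [hx] using h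

end Oscillation

theorem mainTheorem2 {𝕜 : Type*} [RCLike 𝕜] {X : Type*} [MeasurableSpace X]
    (μ : MeasureTheory.Measure X) (φ : X → X)
    (hφ : MeasureTheory.MeasurePreserving φ μ μ)
    (p : ENNReal) (hp : 1 ≤ p) (hp' : p < ⊤)
    (f : X → 𝕜) (hf : MeasureTheory.MemLp f p μ) :
    ∀ᵐ x ∂μ, ∃ l : 𝕜,
      Filter.Tendsto
        (fun n : ℕ => (1 / ((n : 𝕜) + 1)) * ∑ j ∈ Finset.range (n + 1), f (φ^[j] x))
        Filter.atTop (nhds l) := by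
  filter_upwards [ae_exists_tendsto_birkhoffAverage hφ hp hp'.ne hf.re,
    ae_exists_tendsto_birkhoffAverage hφ hp hp'.ne hf.im] with x ⟨r, hr⟩ ⟨s, hs⟩
  refine ⟨(r : 𝕜) + (s : 𝕜) * RCLike.I, ?_⟩
  -- The sum over `j ≤ n` has `n + 1` terms, hence the index shift.
  have hr' := (RCLike.continuous_ofReal (K := 𝕜)).continuousAt.tendsto.comp
    (hr.comp (tendsto_add_atTop_nat 1))
  have hs' := (RCLike.continuous_ofReal (K := 𝕜)).continuousAt.tendsto.comp
    (hs.comp (tendsto_add_atTop_nat 1))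
  refine (hr'.add (hs'.mul_const RCLike.I)).congr fun n => ?_
  simp only [Function.comp_apply, birkhoffAverage, birkhoffSum, smul_eq_mul, RCLike.ofReal_mul,
    RCLike.ofReal_inv, one_div]
  rw [mul_assoc, ← mul_add, ← map_sum, ← map_sum, RCLike.re_add_im]
  push_cast
  rfl
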